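/- Let $0\le k<n$ be integers and let $U\subset\mathbb R^n$ be open, with Cartesian coordinates $x^1,\dots,x^n$. Let $g=(g_{\mu\nu})$ be a (possibly singular) Riemannian metric on $U$, i.e. $(g_{\mu\nu}(x))$ is symmetric and positive definite for almost every $x\in U$; write $(g^{\mu\nu})$ for the inverse matrix, $|g|=\det(g_{\mu\nu})$ and $\operatorname{dvol}_g=\sqrt{|g|}\,dx^1\cdots dx^n$. Suppose that outside of a relatively closed subset $\mathcal S\subset U$ of Lebesgue measure zero the functions $g_{\mu\nu}$ are locally $L^1$ and their first distributional derivatives are (locally $L^1$) functions, and put $\Gamma^\alpha_{\ \beta\mu}=\frac12 g^{\alpha\sigma}(\partial_\beta g_{\sigma\mu}+\partial_\mu g_{\sigma\beta}-\partial_\sigma g_{\beta\mu})$ (repeated indices are summed). Suppose that the coordinates are harmonic, i.e. $g^{\mu\nu}\Gamma^\alpha_{\ \mu\nu}=0$ almost everywhere for every $\alpha$, and that the functions $\sqrt{|g|}\,g^{\mu\nu}\log|g|$ (for all $\mu,\nu$) and $\sqrt{|g|}\,g^{\mu\nu}\Gamma^\alpha_{\ \beta\mu}\Gamma^\beta_{\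 \alpha\nu}$ are in $L^1(U,dx^1\cdots dx^n)$. Let $dR$ be the scalar curvature distribution on $U$ in harmonic coordinates, $dR=\left(-\frac12\triangle_g\log|g|+g^{\mu\nu}\Gamma^\alpha_{\ \beta\mu}\Gamma^\beta_{\ \alpha\nu}\right)\operatorname{dvol}_g$, understood as $$\int_U f\,dR=-\frac12\int_U(\partial_\mu\partial_\nu f)\,\sqrt{|g|}\,g^{\mu\nu}\log|g|\;dx^1\cdots dx^n+\int_U f\,\sqrt{|g|}\,g^{\mu\nu}\Gamma^\alpha_{\ \beta\mu}\Gamma^\beta_{\ \alpha\nu}\;dx^1\cdots dx^n,\qquad f\in C_c^\infty(U).$$ Suppose that $dR$ is a measure, i.e. that it extends to a continuous linear functional on $C_c(U)$ with its LF-topology; equivalently, it is a signed Radon measure on $U$ (a difference of two nonnegative Radon measures). Let $Z\subset U$ be the image of a smooth embedding of the closed $k$-ball, let $\operatorname{int}(Z)$ be the image of the open $k$-ball, and for $\epsilon>0$ let $N_\epsilon(Z)$ be the $\epsilon$-distance neighbourhood of $Z$ with respect to the Euclidean distance (intersected with $U$). If $$\int_{N_\epsilon(Z)}\|g^{\mu\nu}\|\cdot\bigl|\log|g|\bigr|\,\operatorname{dvol}_g=o(\epsilon^2)\quad\text{as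 }\epsilon\to0^+,$$ where $\|\cdot\|$ is the Frobenius norm of matrices, then $dR(W)=0$ for every Borel subset $W$ of $\operatorname{int}(Z)$. -/

import Mathlib

open MeasureTheory TopologicalSpace Topology Asymptotics
open scoped Distributions ContDiff LineDeriv

/-- The coordinate space `ℝⁿ` with its Euclidean norm. -/
abbrev Coord (n : ℕ) : Type := EuclideanSpace ℝ (Fin n)

/-- The coordinate vector field `∂_μ`. -/
noncomputable abbrev coordVec {n : ℕ} (μ : Fin n) : Coord n := EuclideanSpace.single μ (1 : ℝ)

/-- The distribution `f ↦ ∫ f u dx¹ … dxⁿ` on `U` given by a function `u` that is locally `L¹` on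
`U` (and zero if `u` is not). -/
noncomputable def distOfFun {n : ℕ} (U : Opens (Coord n)) (u : Coord n → ℝ) : 𝓓'(U, ℝ) :=
  (TestFunction.integralAgainstBilinCLM (ContinuousLinearMap.mul ℝ ℝ) volume u :
    𝓓(U, ℝ) →L[ℝ] ℝ)

/-- On `V`, both `u` and `w` are locally `L¹`, and `w` is the distributional derivative
`∂_l u`. -/
structure HasWeakPartialDeriv {n : ℕ} (V : Opens (Coord n)) (l : Fin n)
    (u w : Coord n → ℝ) : Prop where
  locallyIntegrable_fun : LocallyIntegrableOn u V
  locallyIntegrable_deriv : LocallyIntegrableOn w V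
  deriv_eq : ∂_{coordVec l} (distOfFun V u) = distOfFun V w

/-- The Christoffel symbol `Γ^α_{βμ} = ½ g^{ασ} (∂_β g_{σμ} + ∂_μ g_{σβ} - ∂_σ g_{βμ})`, where
`dg l` holds the partial derivatives `∂_l g`. -/
noncomputable def christoffel {n : ℕ} (g : Coord n → Matrix (Fin n) (Fin n) ℝ)
    (dg : Fin n → Coord n → Matrix (Fin n) (Fin n) ℝ) (x : Coord n) (α β μ : Fin n) : ℝ :=
  (1 / 2) * ∑ σ, (g x)⁻¹ α σ * (dg β x σ μ + dg μ x σ β - dg σ x β μ)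

/-- The density `√|g|` of `dvol_g` with respect to `dx¹ … dxⁿ`, where `|g| = det (g_{μν})`. -/
noncomputable def volDensity {n : ℕ} (g : Coord n → Matrix (Fin n) (Fin n) ℝ) (x : Coord n) : ℝ :=
  √(g x).det

/-- The function `√|g| g^{μν} log |g|`. -/
noncomputable def logDensity {n : ℕ} (g : Coord n → Matrix (Fin n) (Fin n) ℝ) (μ ν : Fin n)
    (x : Coord n) : ℝ :=
  volDensity g x * (g x)⁻¹ μ ν * Real.log (g x).det

/-- The function `√|g| g^{μν} Γ^α_{βμ} Γ^β_{αν}` (summed over all four indices). -/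
noncomputable def quadDensity {n : ℕ} (g : Coord n → Matrix (Fin n) (Fin n) ℝ)
    (dg : Fin n → Coord n → Matrix (Fin n) (Fin n) ℝ) (x : Coord n) : ℝ :=
  volDensity g x * ∑ μ, ∑ ν, ∑ α, ∑ β,
    (g x)⁻¹ μ ν * christoffel g dg x α β μ * christoffel g dg x β α ν

/-- `g` is a possibly singular Riemannian metric on the harmonic coordinate patch `U`, with first
derivatives `dg`: off the relatively closed null set `U \ V`, the components `g_{μν}` are locally
`L¹` with first distributional derivatives that are functions, and the coordinates are harmonic,
i.e. `g^{μν} Γ^α_{μν} = 0`. -/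
structure IsHarmonicPatch {n : ℕ} (U : Opens (Coord n))
    (g : Coord n → Matrix (Fin n) (Fin n) ℝ)
    (dg : Fin n → Coord n → Matrix (Fin n) (Fin n) ℝ) : Prop where
  posDef : ∀ᵐ x ∂(volume.restrict (U : Set (Coord n))), (g x).PosDef
  regular : ∃ V : Opens (Coord n), V ≤ U ∧ volume ((U : Set (Coord n)) \ V) = 0 ∧
    ∀ l μ ν, HasWeakPartialDeriv V l (fun x => g x μ ν) (fun x => dg l x μ ν)
  harmonic : ∀ᵐ x ∂(volume.restrict (U : Set (Coord n))), ∀ α,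
    ∑ μ, ∑ ν, (g x)⁻¹ μ ν * christoffel g dg x α μ ν = 0

/-- The scalar curvature distribution
`dR = (-½ Δ_g log |g| + g^{μν} Γ^α_{βμ} Γ^β_{αν}) dvol_g` in harmonic coordinates, where
`(Δ_g log |g|) dvol_g` is the distribution `∂_μ ∂_ν (√|g| g^{μν} log |g|)`; see
`scalarCurvature_apply` for its value on a test function. -/
noncomputable def scalarCurvature {n : ℕ} (U : Opens (Coord n))
    (g : Coord n → Matrix (Fin n) (Fin n) ℝ)
    (dg : Fin n → Coord n → Matrix (Fin n) (Fin n) ℝ) : 𝓓'(U, ℝ) :=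
  (-(1 / 2) : ℝ) •
      (∑ μ, ∑ ν, ∂_{coordVec μ} (∂_{coordVec ν} (distOfFun U (logDensity g μ ν)))) +
    distOfFun U (quadDensity g dg)

theorem distOfFun_apply {n : ℕ} {U : Opens (Coord n)} {u : Coord n → ℝ}
    (hu : LocallyIntegrableOn u U) (f : 𝓓(U, ℝ)) : distOfFun U u f = ∫ x, f x * u x := by
  change (TestFunction.integralAgainstBilinCLM (ContinuousLinearMap.mul ℝ ℝ) volume u :
    𝓓(U, ℝ) →L[ℝ] ℝ) f = _
  rw [TestFunction.integralAgainstBilinCLM_eq_integral hu]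
  rfl

/-- `∫ f dR = -½ ∫ (∂_μ ∂_ν f) √|g| g^{μν} log |g| dx + ∫ f √|g| g^{μν} Γ^α_{βμ} Γ^β_{αν} dx`. -/
theorem scalarCurvature_apply {n : ℕ} {U : Opens (Coord n)}
    {g : Coord n → Matrix (Fin n) (Fin n) ℝ}
    {dg : Fin n → Coord n → Matrix (Fin n) (Fin n) ℝ}
    (hlog : ∀ μ ν, LocallyIntegrableOn (logDensity g μ ν) U)
    (hquad : LocallyIntegrableOn (quadDensity g dg) U) (f : 𝓓(U, ℝ)) :
    scalarCurvature U g dg f =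
      -(1 / 2) * (∑ μ, ∑ ν,
        ∫ x, (∂_{coordVec ν} (∂_{coordVec μ} f)) x * logDensity g μ ν x) +
      ∫ x, f x * quadDensity g dg x := by
  have h : ∀ μ ν, ∫ x, (∂_{coordVec ν} (∂_{coordVec μ} f)) x * logDensity g μ ν x =
      (∂_{coordVec μ} (∂_{coordVec ν} (distOfFun U (logDensity g μ ν)))) f := by
    intro μ ν
    rw [← distOfFun_apply (hlog μ ν), Distribution.lineDerivOp_apply_apply,
      Distribution.lineDerivOp_apply_apply, map_neg, LineDeriv.lineDerivOp_neg, map_neg, neg_neg]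
  rw [← distOfFun_apply hquad]
  simp only [h]
  simp [scalarCurvature]

/-- The distribution `T` on `U` is a measure: it extends to a continuous linear functional on
`C_c(U)` with its LF topology, which is the space `𝓓^{0}(U, ℝ)`. -/
def IsMeasureDist {n : ℕ} {U : Opens (Coord n)} (T : 𝓓'(U, ℝ)) : Prop :=
  ∃ L : 𝓓'^{0}(U, ℝ), ∀ f : 𝓓(U, ℝ), L (TestFunction.monoCLM ℝ f) = T f

/-- `T` is the signed Radon measure `m₁ - m₂` on `U`, where `m₁`, `m₂` are (nonnegative) measures
that are finite on compact subsets of `U`. For a Borel set `W` inside a compact subset of `U`, its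
value on `W` is `m₁ W - m₂ W`. -/
structure IsSignedRadon {n : ℕ} {U : Opens (Coord n)} (T : 𝓓'(U, ℝ))
    (m₁ m₂ : Measure (Coord n)) : Prop where
  finite_left : ∀ K ⊆ (U : Set (Coord n)), IsCompact K → m₁ K < ⊤
  finite_right : ∀ K ⊆ (U : Set (Coord n)), IsCompact K → m₂ K < ⊤
  apply_eq : ∀ f : 𝓓(U, ℝ), T f = (∫ x, f x ∂m₁) - (∫ x, f x ∂m₂)

/-- The closed unit ball of `ℝᵏ`. -/
abbrev closedUnitBall (k : ℕ) : Set (Coord k) := Metric.closedBall 0 1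

/-- `e` restricts to a smooth embedding of the closed unit ball of `ℝᵏ` into `ℝⁿ`: smooth up to the
boundary, injective, with injective differential at every point of the closed ball. (By compactness
it is then a homeomorphism onto its image.) -/
structure IsClosedBallEmbedding {k n : ℕ} (e : Coord k → Coord n) : Prop where
  smooth : ContDiffOn ℝ ∞ e (closedUnitBall k)
  injective : Set.InjOn e (closedUnitBall k)
  immersion : ∀ t ∈ closedUnitBall k,
    Function.Injective (fderivWithin ℝ e (closedUnitBall k) t)

section
attribute [local instance] Matrix.frobeniusNormedAddCommGroup

/-- The function `‖g^{μν}‖ · |log |g|| · √|g|`, with the Frobenius norm of the matrix `g^{μν}`. -/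
noncomputable def normLogDensity {n : ℕ} (g : Coord n → Matrix (Fin n) (Fin n) ℝ)
    (x : Coord n) : ℝ :=
  ‖(g x)⁻¹‖ * |Real.log (g x).det| * volDensity g x

end

/-! The closed-ball image `Z` is compact, and Lebesgue-null because `k < n`
(`volume_image_eq_zero_of_lt`). For compact `K ⊆ Z`, test `dR` on cutoffs `η_ε` equal to 1 on `K`,
supported in the `ε`-neighbourhood of `K`, with second derivatives at most `C / ε²`
(`exists_cutoff`). The logarithmic term is then at most `C / ε²` times an `o(ε²)` integral, so it
tends to 0. The quadratic term tends to the integral of an `L¹` function over the null set `K`,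
which is 0. The left side tends to `m₁ K - m₂ K`, so the two measures agree on `K`
(`measure_eq_of_isCompact_of_isSignedRadon`). Closed subsets of `Z` form a π-system, which extends
the equality to Borel subsets (`measure_eq_of_forall_isClosed`).

That `m₁` and `m₂` exist is a signed Riesz theorem: a functional of order zero is bounded on each
order interval `[0, f]`, hence is a difference of two positive functionals, and each of these is
represented by a measure. -/

/-! ### Jordan decomposition of order bounded functionals -/

section OrderBoundedFunctional

open scoped NNReal CompactlySupported

variable {X : Type*} [TopologicalSpace X]

/-- The supremum of an additive functional over the order interval `[0, f]`. -/
noncomputable def supBelow (A : C_c(X, ℝ≥0) →ₗ[ℝ≥0] ℝ) (f : C_c(X, ℝ≥0)) : ℝ :=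
  sSup (A '' Set.Iic f)

/-- Riesz decomposition: any `h ≤ f + g` splits as `h ⊓ f`, which lies below `f`, plus a remainder
lying below `g`. -/
theorem supBelow_add (A : C_c(X, ℝ≥0) →ₗ[ℝ≥0] ℝ) (hA : ∀ f, BddAbove (A '' Set.Iic f))
    (f g : C_c(X, ℝ≥0)) : supBelow A (f + g) = supBelow A f + supBelow A g := by
  have hne : ∀ f, (A '' Set.Iic f).Nonempty := fun f => ⟨_, f, le_refl f, rfl⟩
  apply le_antisymm
  · apply csSup_le (hne _)
    rintro _ ⟨h, hh, rfl⟩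
    obtain ⟨r, hr⟩ := CompactlySupportedContinuousMap.exists_add_of_le (inf_le_left : h ⊓ f ≤ h)
    have hrg : r ≤ g := by
      intro x
      have h1 : (h ⊓ f) x + r x = h x := DFunLike.congr_fun hr x
      have h2 : h x ≤ f x + g x := hh x
      have h3 : (h ⊓ f) x = min (h x) (f x) := rfl
      rw [h3] at h1
      rcases le_total (h x) (f x) with h4 | h4
      · rw [min_eq_left h4] at h1
        have : r x = 0 := by simpa using h1
        change r x ≤ g x
        simp [this]
      · rw [min_eq_right h4, ← h1] at *
        exact le_of_add_le_add_left h2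
    calc A h = A (h ⊓ f) + A r := by rw [← map_add, hr]
      _ ≤ _ := add_le_add (le_csSup (hA f) ⟨_, (inf_le_right : h ⊓ f ≤ f), rfl⟩)
        (le_csSup (hA g) ⟨_, hrg, rfl⟩)
  · rw [← le_sub_iff_add_le]
    apply csSup_le (hne _)
    rintro _ ⟨h, hh, rfl⟩
    rw [le_sub_comm]
    apply csSup_le (hne _)
    rintro _ ⟨k, hk, rfl⟩
    rw [le_sub_iff_add_le, add_comm, ← map_add]
    exact le_csSup (hA _) ⟨_, fun x => add_le_add (hh x) (hk x), rfl⟩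

theorem supBelow_smul_le (A : C_c(X, ℝ≥0) →ₗ[ℝ≥0] ℝ) (hA : ∀ f, BddAbove (A '' Set.Iic f))
    (c : ℝ≥0) (f : C_c(X, ℝ≥0)) : c * supBelow A f ≤ supBelow A (c • f) := by
  rcases eq_or_ne c 0 with rfl | hc
  · simp only [NNReal.coe_zero, zero_mul]
    exact le_csSup (hA _) ⟨0, fun x => by simp, by simp⟩
  · have hc' : (0 : ℝ) < c := by positivity
    rw [← le_div_iff₀' hc']
    refine csSup_le (Set.Nonempty.image _ ⟨f, le_refl f⟩) ?_
    rintro _ ⟨h, hh, rfl⟩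
    rw [le_div_iff₀' hc']
    refine le_csSup (hA _) ⟨c • h, fun x => ?_, ?_⟩
    · exact mul_le_mul_right (hh x) c
    · rw [map_smul]; rfl

/-- For `c ≠ 0` the missing inequality is `supBelow_smul_le` applied to `c⁻¹` and `c • f`. -/
theorem supBelow_smul (A : C_c(X, ℝ≥0) →ₗ[ℝ≥0] ℝ) (hA : ∀ f, BddAbove (A '' Set.Iic f))
    (c : ℝ≥0) (f : C_c(X, ℝ≥0)) : supBelow A (c • f) = c * supBelow A f := by
  apply le_antisymm _ (supBelow_smul_le A hA c f)
  rcases eq_or_ne c 0 with rfl | hc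
  · simp only [NNReal.coe_zero, zero_mul, zero_smul]
    refine csSup_le (Set.Nonempty.image _ ⟨0, Set.self_mem_Iic⟩) ?_
    rintro _ ⟨h, hh, rfl⟩
    have : h = 0 := by
      ext x
      simpa using hh x
    simp [this]
  · have := supBelow_smul_le A hA c⁻¹ (c • f)
    rw [smul_smul, inv_mul_cancel₀ hc, one_smul, NNReal.coe_inv,
      inv_mul_le_iff₀ (by positivity)] at this
    exact this

theorem le_supBelow (A : C_c(X, ℝ≥0) →ₗ[ℝ≥0] ℝ) (hA : ∀ f, BddAbove (A '' Set.Iic f))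
    (f : C_c(X, ℝ≥0)) : A f ≤ supBelow A f :=
  le_csSup (hA f) ⟨f, le_refl f, rfl⟩

theorem supBelow_nonneg (A : C_c(X, ℝ≥0) →ₗ[ℝ≥0] ℝ) (hA : ∀ f, BddAbove (A '' Set.Iic f))
    (f : C_c(X, ℝ≥0)) : 0 ≤ supBelow A f :=
  le_csSup (hA f) ⟨0, fun x => by simp, by simp⟩

/-- An order bounded linear functional is a difference of two positive ones. -/
theorem exists_eq_sub_of_bddAbove (A : C_c(X, ℝ≥0) →ₗ[ℝ≥0] ℝ)
    (hA : ∀ f, BddAbove (A '' Set.Iic f)) :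
    ∃ P N : C_c(X, ℝ≥0) →ₗ[ℝ≥0] ℝ≥0, ∀ f, A f = P f - N f := by
  -- The positive part is `supBelow A`, the negative part `supBelow A - A`; they are nonnegative
  -- because `0` and `f` both lie in `[0, f]`.
  refine ⟨⟨⟨fun f => ⟨supBelow A f, supBelow_nonneg A hA f⟩, fun f g => ?_⟩, fun c f => ?_⟩,
    ⟨⟨fun f => ⟨supBelow A f - A f, sub_nonneg.2 (le_supBelow A hA f)⟩, fun f g => ?_⟩,
      fun c f => ?_⟩, fun f => ?_⟩
  · exact NNReal.eq (supBelow_add A hA f g)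
  · exact NNReal.eq (supBelow_smul A hA c f)
  · apply NNReal.eq
    change supBelow A (f + g) - A (f + g) = (supBelow A f - A f) + (supBelow A g - A g)
    rw [supBelow_add A hA, map_add]
    ring
  · apply NNReal.eq
    change supBelow A (c • f) - A (c • f) = c * (supBelow A f - A f)
    rw [supBelow_smul A hA, map_smul, NNReal.smul_def, smul_eq_mul]
    ring
  · change A f = supBelow A f - (supBelow A f - A f)
    ring

/-- Signed version of the Riesz–Markov–Kakutani theorem. -/
theorem exists_measures_of_bddAbove [T2Space X] [LocallyCompactSpace X] [MeasurableSpace X]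
    [BorelSpace X] (A : C_c(X, ℝ≥0) →ₗ[ℝ≥0] ℝ) (hA : ∀ f, BddAbove (A '' Set.Iic f)) :
    ∃ m₁ m₂ : Measure X, m₁.Regular ∧ m₂.Regular ∧
      ∀ f : C_c(X, ℝ≥0), A f = (∫ x, (f x : ℝ) ∂m₁) - ∫ x, (f x : ℝ) ∂m₂ := by
  obtain ⟨P, N, h⟩ := exists_eq_sub_of_bddAbove A hA
  refine ⟨NNRealRMK.rieszMeasure P, NNRealRMK.rieszMeasure N, inferInstance, inferInstance,
    fun f => ?_⟩
  rw [h, NNRealRMK.integral_rieszMeasure, NNRealRMK.integral_rieszMeasure]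

end OrderBoundedFunctional

/-! ### From distributions of order zero to signed Radon measures -/

section ExtendByZero

open scoped NNReal CompactlySupported

variable {n : ℕ} {U : Opens (Coord n)}

/-- Extension by zero of a compactly supported function on `U`. -/
noncomputable def extendZero (f : C_c(U, ℝ≥0)) : 𝓓^{0}(U, ℝ) where
  toFun := Function.extend (Subtype.val : U → Coord n) (fun x => (f x : ℝ)) 0
  contDiff' := by
    have h : HasCompactSupport (fun x => (f x : ℝ)) :=
      f.hasCompactSupport.comp_left (g := ((↑) : ℝ≥0 → ℝ)) rfl
    exact contDiff_zero.2 (h.continuous_extend_zero U.2 (by fun_prop))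
  hasCompactSupport' := by
    have h : HasCompactSupport (fun x => (f x : ℝ)) :=
      f.hasCompactSupport.comp_left (g := ((↑) : ℝ≥0 → ℝ)) rfl
    exact h.extend_zero continuous_subtype_val
  tsupport_subset' := by
    have h : HasCompactSupport (fun x => (f x : ℝ)) :=
      f.hasCompactSupport.comp_left (g := ((↑) : ℝ≥0 → ℝ)) rfl
    refine (h.tsupport_extend_zero_subset continuous_subtype_val).trans ?_
    rintro _ ⟨x, -, rfl⟩
    exact x.2

theorem extendZero_apply (f : C_c(U, ℝ≥0)) (x : U) : extendZero f x = f x :=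
  Subtype.val_injective.extend_apply (fun x => (f x : ℝ)) 0 x

theorem extendZero_apply_of_notMem (f : C_c(U, ℝ≥0)) {x : Coord n} (hx : x ∉ U) :
    extendZero f x = 0 :=
  Function.extend_apply' (f := (Subtype.val : U → Coord n)) (fun x => (f x : ℝ)) 0 x
    (by rintro ⟨y, rfl⟩; exact hx y.2)

/-- A distribution of order zero as a functional on the nonnegative functions in `C_c(U)`. -/
noncomputable def nonnegFunctional (L : 𝓓'^{0}(U, ℝ)) : C_c(U, ℝ≥0) →ₗ[ℝ≥0] ℝ where
  toFun f := L (extendZero f)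
  map_add' f g := by
    rw [← map_add]
    congr 1
    ext x
    by_cases hx : x ∈ U
    · lift x to U using hx
      simp [extendZero_apply]
    · simp [extendZero_apply_of_notMem _ hx]
  map_smul' c f := by
    rw [RingHom.id_apply, NNReal.smul_def, ← map_smul]
    congr 1
    ext x
    by_cases hx : x ∈ U
    · lift x to U using hx
      simp [extendZero_apply]
    · simp [extendZero_apply_of_notMem _ hx]

/-- A distribution of order zero is bounded in the sup norm on functions with support in a given
compact set. -/
theorem exists_bound_of_supported (L : 𝓓'^{0}(U, ℝ)) (K : Compacts (Coord n))
    (hK : (K : Set (Coord n)) ⊆ U) :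
    ∃ C : ℝ, ∀ f : 𝓓^{0}(U, ℝ), Function.support f ⊆ K → ∀ M : ℝ, 0 ≤ M →
      (∀ x, |f x| ≤ M) → |L f| ≤ C * M := by
  -- Continuity for the LF topology restricts to functions supported in `K`. There, at order zero,
  -- only the sup norm remains among the seminorms.
  let T : 𝓓^{0}_{K}(Coord n, ℝ) →L[ℝ] ℝ := L.comp (TestFunction.ofSupportedInCLM ℝ hK)
  obtain ⟨s, C, -, hC⟩ := Seminorm.bound_of_continuous
    (ContDiffMapSupportedIn.withSeminorms ℝ (Coord n) ℝ 0 K)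
    ((normSeminorm ℝ ℝ).comp T.toLinearMap) (by
      change Continuous fun f => ‖T f‖
      fun_prop)
  refine ⟨C, fun f hf M hM hfM => ?_⟩
  let fK : 𝓓^{0}_{K}(Coord n, ℝ) := .of_support_subset f.contDiff hf
  have h1 : ‖T fK‖ ≤ C * (s.sup (ContDiffMapSupportedIn.seminorm ℝ (Coord n) ℝ 0 K)) fK := hC fK
  have h2 : (s.sup (ContDiffMapSupportedIn.seminorm ℝ (Coord n) ℝ 0 K)) fK ≤ M := by
    refine Seminorm.finset_sup_apply_le hM fun i _ => ?_
    rw [ContDiffMapSupportedIn.seminorm_le_iff ℝ hM]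
    intro hi x _
    obtain rfl : i = 0 := by simpa using hi
    rw [norm_iteratedFDeriv_zero]
    exact hfM x
  exact h1.trans (mul_le_mul_of_nonneg_left h2 C.2)

/-- All `h` in `[0, f]` share the compact support and the sup bound of `f`, so one constant serves
for all of them. -/
theorem bddAbove_nonnegFunctional (L : 𝓓'^{0}(U, ℝ)) (f : C_c(U, ℝ≥0)) :
    BddAbove (nonnegFunctional L '' Set.Iic f) := by
  have hK : IsCompact ((Subtype.val : U → Coord n) '' tsupport f) :=
    f.hasCompactSupport.isCompact.image continuous_subtype_val
  obtain ⟨C, hC⟩ := exists_bound_of_supported L ⟨_, hK⟩ (by rintro _ ⟨x, -, rfl⟩; exact x.2)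
  obtain ⟨M, hM⟩ := (extendZero f).continuous.bounded_above_of_compact_support
    (extendZero f).hasCompactSupport
  have hM0 : 0 ≤ max M 0 := le_max_right _ _
  refine ⟨C * max M 0, ?_⟩
  rintro _ ⟨h, hh, rfl⟩
  refine (le_abs_self _).trans (hC _ ?_ _ hM0 fun x => ?_)
  · intro x hx
    by_cases hxU : x ∈ U
    · lift x to U using hxU
      refine ⟨x, subset_tsupport _ ?_, rfl⟩
      rw [Function.mem_support, extendZero_apply] at hx
      rw [Function.mem_support]
      intro h0
      have h1 := hh x
      change h x ≤ f x at h1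
      rw [h0] at h1
      apply hx
      simpa using h1
    · exact absurd (extendZero_apply_of_notMem _ hxU) hx
  · by_cases hxU : x ∈ U
    · lift x to U using hxU
      rw [extendZero_apply, NNReal.abs_eq]
      have h1 : h x ≤ f x := hh x
      have h2 := hM x
      rw [extendZero_apply, Real.norm_eq_abs, NNReal.abs_eq] at h2
      exact le_max_of_le_left ((NNReal.coe_le_coe.2 h1).trans h2)
    · simp [extendZero_apply_of_notMem _ hxU]

theorem isCompact_preimage_subtype_val {K : Set (Coord n)} (hKU : K ⊆ (U : Set (Coord n)))
    (hK : IsCompact K) : IsCompact ((Subtype.val : U → Coord n) ⁻¹' K) :=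
  (Topology.IsInducing.subtypeVal.isCompact_preimage_iff fun x hx => ⟨⟨x, hKU hx⟩, rfl⟩).2 hK

theorem measurableEmbedding_subtype_val : MeasurableEmbedding (Subtype.val : U → Coord n) :=
  MeasurableEmbedding.subtype_coe U.2.measurableSet

/-- The restriction of a test function to `U`, as an element of `C_c(U)`. -/
noncomputable def restrictToOpen (f : 𝓓(U, ℝ)) : C_c(U, ℝ) where
  toFun x := f x
  continuous_toFun := f.continuous.comp continuous_subtype_val
  hasCompactSupport' := by
    have hK := isCompact_preimage_subtype_val f.tsupport_subset f.hasCompactSupport.isCompact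
    exact HasCompactSupport.of_support_subset_isCompact hK fun x hx => subset_tsupport _ hx

theorem integral_map_subtype_val (m : Measure U) [IsFiniteMeasureOnCompacts m] (f : 𝓓(U, ℝ)) :
    ∫ x, f x ∂(m.map Subtype.val) = (∫ x, ((restrictToOpen f).nnrealPart x : ℝ) ∂m) -
      ∫ x, ((-restrictToOpen f).nnrealPart x : ℝ) ∂m := by
  have hi : ∀ g : C_c(U, ℝ≥0), Integrable (fun x => (g x : ℝ)) m := fun g =>
    Continuous.integrable_of_hasCompactSupport (by fun_prop)
      (g.hasCompactSupport.comp_left (g := ((↑) : ℝ≥0 → ℝ)) rfl)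
  rw [measurableEmbedding_subtype_val.integral_map, ← integral_sub (hi _) (hi _)]
  refine integral_congr_ae (.of_forall fun x => ?_)
  change f x = ((f x).toNNReal : ℝ) - ((-f x).toNNReal : ℝ)
  rw [Real.coe_toNNReal', Real.coe_toNNReal', max_zero_sub_max_neg_zero_eq_self]

/-- A distribution that is a measure is a signed Radon measure. -/
theorem IsMeasureDist.exists_isSignedRadon {T : 𝓓'(U, ℝ)} (hT : IsMeasureDist T) :
    ∃ m₁ m₂ : Measure (Coord n), IsSignedRadon T m₁ m₂ := by
  obtain ⟨L, hL⟩ := hT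
  -- Riesz–Markov is applied on `U` itself, and the measures are then pushed forward to `ℝⁿ`; only
  -- compact subsets of `U` are sure to have finite mass.
  have : LocallyCompactSpace U := U.2.locallyCompactSpace
  obtain ⟨m₁, m₂, h₁, h₂, h⟩ :=
    exists_measures_of_bddAbove (nonnegFunctional L) (bddAbove_nonnegFunctional L)
  have hfin : ∀ (m : Measure U), IsFiniteMeasureOnCompacts m → ∀ K ⊆ (U : Set (Coord n)),
      IsCompact K → m.map Subtype.val K < ⊤ := by
    intro m _ K hKU hK
    rw [measurableEmbedding_subtype_val.map_apply]
    exact (isCompact_preimage_subtype_val hKU hK).measure_lt_top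
  refine ⟨m₁.map Subtype.val, m₂.map Subtype.val, hfin m₁ inferInstance, hfin m₂ inferInstance,
    fun f => ?_⟩
  have hf : TestFunction.monoCLM ℝ f = extendZero (restrictToOpen f).nnrealPart -
      extendZero (-restrictToOpen f).nnrealPart := by
    ext x
    have h1 : (TestFunction.monoCLM ℝ f : 𝓓^{0}(U, ℝ)) x = f x := by simp
    rw [h1]
    by_cases hx : x ∈ U
    · lift x to U using hx
      rw [sub_apply, extendZero_apply, extendZero_apply]
      change f x = ((f x).toNNReal : ℝ) - ((-f x).toNNReal : ℝ)
      rw [Real.coe_toNNReal', Real.coe_toNNReal', max_zero_sub_max_neg_zero_eq_self]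
    · rw [sub_apply, extendZero_apply_of_notMem _ hx, extendZero_apply_of_notMem _ hx,
        sub_zero]
      exact image_eq_zero_of_notMem_tsupport fun h => hx (f.tsupport_subset h)
  have e : ∀ g, L (extendZero g) = _ := h
  rw [← hL f, hf, map_sub, e, e, integral_map_subtype_val, integral_map_subtype_val]
  ring

end ExtendByZero

/-! ### Cutoff functions with scaled second derivative bounds -/

theorem fderiv_comp_smul_apply {E : Type*} [NormedAddCommGroup E] [NormedSpace ℝ E] (c : ℝ)
    {f : E → ℝ} (hf : Differentiable ℝ f) (x v : E) :
    fderiv ℝ (fun y => f (c • y)) x v = c * fderiv ℝ f (c • x) v := by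
  have h : HasFDerivAt (fun y => f (c • y)) _ x :=
    (hf (c • x)).hasFDerivAt.comp x ((hasFDerivAt_id x).const_smul c)
  rw [h.fderiv]
  simp

section Cutoff

open scoped Convolution
open ContinuousLinearMap (lsmul)

variable {E : Type*} [NormedAddCommGroup E] [NormedSpace ℝ E] [FiniteDimensional ℝ E]
  [MeasurableSpace E] [BorelSpace E]

theorem fderiv_convolution_apply (μ : Measure E) [μ.IsAddHaarMeasure] {f g : E → ℝ}
    (hf : LocallyIntegrable f μ) (hg : ContDiff ℝ 1 g) (hgc : HasCompactSupport g) (x v : E) :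
    fderiv ℝ (f ⋆[lsmul ℝ ℝ, μ] g) x v = (f ⋆[lsmul ℝ ℝ, μ] fun y => fderiv ℝ g y v) x := by
  rw [(hgc.hasFDerivAt_convolution_right (lsmul ℝ ℝ) hf hg x).fderiv]
  exact convolution_precompR_apply _ hf (hgc.fderiv ℝ) (hg.continuous_fderiv one_ne_zero) x v

/-- The bound does not involve `B`; this is what makes the cutoff constants uniform in the set. -/
theorem abs_indicator_convolution_le (μ : Measure E) [μ.IsAddHaarMeasure] (B : Set E)
    {h : E → ℝ} (hh : Integrable h μ) (x : E) :
    |((B.indicator 1 : E → ℝ) ⋆[lsmul ℝ ℝ, μ] h) x| ≤ ∫ y, |h y| ∂μ := by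
  rw [convolution_def, ← integral_sub_left_eq_self (fun y => |h y|) μ x, ← Real.norm_eq_abs]
  have hi : Integrable (fun t => h (x - t)) μ := hh.comp_sub_left x
  refine norm_integral_le_of_norm_le hi.abs (.of_forall fun t => ?_)
  by_cases ht : t ∈ B <;> simp [ht]

/-- Cutoff functions at scale `1`, with a bound on the second derivatives that does not depend on
the set. -/
theorem exists_unit_cutoff {ι : Type*} [Finite ι] (v : ι → E) :
    ∃ C : ℝ, ∀ A : Set E, ∃ η : E → ℝ, ContDiff ℝ ∞ η ∧ (∀ x, 0 ≤ η x ∧ η x ≤ 1) ∧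
      (∀ x ∈ A, η x = 1) ∧ tsupport η ⊆ Metric.thickening 1 A ∧
      ∀ i j x, |fderiv ℝ (fun y => fderiv ℝ η y (v i)) x (v j)| ≤ C := by
  let μ : Measure E := Measure.addHaar
  -- The cutoff is the indicator of the `1/2`-thickening `B` mollified at radius `1/4`: it is 1 on
  -- `A` and vanishes off the closed `3/4`-thickening, so its closed support stays within distance
  -- 1.
  let φ : ContDiffBump (0 : E) := ⟨1 / 8, 1 / 4, by norm_num, by norm_num⟩
  let ρ : E → ℝ := φ.normed μ
  have hρ : ContDiff ℝ ∞ ρ := φ.contDiff_normed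
  have hρc : HasCompactSupport ρ := φ.hasCompactSupport_normed
  let D : ι → E → ℝ := fun i y => fderiv ℝ ρ y (v i)
  have hD : ∀ i, ContDiff ℝ ∞ (D i) := fun i =>
    (hρ.fderiv_right (m := ∞) (by norm_cast)).clm_apply contDiff_const
  have hDc : ∀ i, HasCompactSupport (D i) := fun i => hρc.fderiv_apply ℝ (v i)
  let D₂ : ι → ι → E → ℝ := fun i j y => fderiv ℝ (D i) y (v j)
  have hD₂ : ∀ i j, Integrable (D₂ i j) μ := fun i j =>
    Continuous.integrable_of_hasCompactSupport
      ((((hD i).fderiv_right (m := ∞) (by norm_cast)).clm_apply contDiff_const).continuous)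
      ((hDc i).fderiv_apply ℝ (v j))
  -- `C` bounds the `L¹` norms of the second derivatives of the mollifier, and is fixed before `A`.
  obtain ⟨C, hC⟩ := (Set.finite_range fun p : ι × ι => ∫ y, |D₂ p.1 p.2 y| ∂μ).bddAbove
  refine ⟨C, fun A => ?_⟩
  let B : Set E := Metric.thickening (1 / 2) A
  have hB : MeasurableSet B := Metric.isOpen_thickening.measurableSet
  let χ : E → ℝ := B.indicator 1
  have hχ : LocallyIntegrable χ μ := (locallyIntegrable_const (1 : ℝ)).indicator hB
  have h01 : ∀ x, 0 ≤ χ x ∧ χ x ≤ 1 := fun x =>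
    ⟨Set.indicator_nonneg (fun _ _ => zero_le_one) x,
      Set.indicator_le_self' (f := (1 : E → ℝ)) (fun _ _ => zero_le_one) x⟩
  have hflip : ∀ x, (χ ⋆[lsmul ℝ ℝ, μ] ρ) x = (ρ ⋆[lsmul ℝ ℝ, μ] χ) x := by
    intro x
    rw [convolution_lsmul, convolution_lsmul_swap]
    simp only [smul_eq_mul, mul_comm]
  have hint : ∀ x, Integrable (fun t => χ t * ρ (x - t)) μ := fun x =>
    (hρc.convolutionExists_right (lsmul ℝ ℝ) hχ hρ.continuous x).integrable
  have hρint : ∀ x, Integrable (fun t => ρ (x - t)) μ := fun x =>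
    (φ.integrable_normed (μ := μ)).comp_sub_left x
  refine ⟨χ ⋆[lsmul ℝ ℝ, μ] ρ, hρc.contDiff_convolution_right _ hχ hρ, fun x => ⟨?_, ?_⟩,
    fun x hx => ?_, ?_, fun i j x => ?_⟩
  · rw [convolution_lsmul]
    exact integral_nonneg fun t => mul_nonneg (h01 t).1 (φ.nonneg_normed _)
  · rw [convolution_lsmul]
    calc ∫ t, χ t • ρ (x - t) ∂μ ≤ ∫ t, ρ (x - t) ∂μ :=
          integral_mono (hint x) (hρint x) fun t =>
            mul_le_of_le_one_left (φ.nonneg_normed _) (h01 t).2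
      _ = 1 := by rw [integral_sub_left_eq_self ρ μ x]; exact φ.integral_normed
  · have hb : ∀ y ∈ Metric.ball x φ.rOut, y ∈ B := fun y hy =>
      Metric.mem_thickening_iff.2 ⟨x, hx, (Metric.mem_ball.1 hy).trans (by norm_num [φ])⟩
    have hxB : x ∈ B := hb x (Metric.mem_ball_self φ.rOut_pos)
    rw [hflip]
    change (φ.normed μ ⋆[lsmul ℝ ℝ, μ] χ) x = 1
    rw [φ.normed_convolution_eq_right fun y hy => by simp [χ, hb y hy, hxB]]
    simp [χ, hxB]
  · have hs : Function.support (χ ⋆[lsmul ℝ ℝ, μ] ρ) ⊆ Metric.cthickening (3 / 4) A := by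
      intro x hx
      by_contra hxA
      have hb : ∀ y ∈ Metric.ball x φ.rOut, y ∉ B := by
        intro y hy hyB
        obtain ⟨z, hz, hyz⟩ := Metric.mem_thickening_iff.1 hyB
        refine hxA (Metric.thickening_subset_cthickening _ _
          (Metric.mem_thickening_iff.2 ⟨z, hz, ?_⟩))
        have h1 : dist y x < 1 / 4 := hy
        have := dist_triangle_left x z y
        linarith
      have hxB : x ∉ B := hb x (Metric.mem_ball_self φ.rOut_pos)
      apply hx
      rw [hflip]
      change (φ.normed μ ⋆[lsmul ℝ ℝ, μ] χ) x = 0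
      rw [φ.normed_convolution_eq_right fun y hy => by simp [χ, hb y hy, hxB]]
      simp [χ, hxB]
    exact (closure_minimal hs Metric.isClosed_cthickening).trans
      (Metric.cthickening_subset_thickening' one_pos (by norm_num) A)
  · have h1 : (fun y => fderiv ℝ (χ ⋆[lsmul ℝ ℝ, μ] ρ) y (v i)) = χ ⋆[lsmul ℝ ℝ, μ] D i :=
      funext fun y => fderiv_convolution_apply μ hχ (hρ.of_le (by norm_cast)) hρc y _
    rw [h1, fderiv_convolution_apply μ hχ ((hD i).of_le (by norm_cast)) (hDc i)]
    exact (abs_indicator_convolution_le μ B (hD₂ i j) x).trans (hC ⟨(i, j), rfl⟩)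

/-- Cutoff functions at scale `ε`, with second derivatives bounded by `C / ε ^ 2`, where `C` does
not depend on the set. -/
theorem exists_cutoff {ι : Type*} [Finite ι] (v : ι → E) :
    ∃ C : ℝ, ∀ (A : Set E) (ε : ℝ), 0 < ε → ∃ η : E → ℝ, ContDiff ℝ ∞ η ∧
      (∀ x, 0 ≤ η x ∧ η x ≤ 1) ∧ (∀ x ∈ A, η x = 1) ∧ tsupport η ⊆ Metric.thickening ε A ∧
      ∀ i j x, |fderiv ℝ (fun y => fderiv ℝ η y (v i)) x (v j)| ≤ C / ε ^ 2 := by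
  obtain ⟨C, hC⟩ := exists_unit_cutoff v
  refine ⟨C, fun A ε hε => ?_⟩
  -- The rescaled set varies with `ε`, so uniformity of `C` over all sets is essential here. Each
  -- derivative of the rescaled cutoff contributes a factor `ε⁻¹`.
  obtain ⟨η, hη, h01, h1, hsupp, hbd⟩ := hC ((fun x => ε⁻¹ • x) '' A)
  refine ⟨fun x => η (ε⁻¹ • x), hη.comp (contDiff_const_smul _), fun x => h01 _,
    fun x hx => h1 _ ⟨x, hx, rfl⟩, ?_, fun i j x => ?_⟩
  · intro x hx
    have hx' : ε⁻¹ • x ∈ tsupport η :=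
      tsupport_comp_subset_preimage η (continuous_const_smul ε⁻¹) hx
    obtain ⟨_, ⟨z, hz, rfl⟩, hd⟩ := Metric.mem_thickening_iff.1 (hsupp hx')
    refine Metric.mem_thickening_iff.2 ⟨z, hz, ?_⟩
    change dist (ε⁻¹ • x) (ε⁻¹ • z) < 1 at hd
    rw [dist_smul₀, norm_inv, Real.norm_of_nonneg hε.le, inv_mul_lt_iff₀ hε, mul_one] at hd
    exact hd
  · have hd : Differentiable ℝ η := hη.differentiable (by simp)
    have hd' : Differentiable ℝ fun y => fderiv ℝ η y (v i) :=
      ((hη.fderiv_right (m := ∞) (by norm_cast)).clm_apply contDiff_const).differentiable (by simp)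
    have e1 : (fun y => fderiv ℝ (fun x => η (ε⁻¹ • x)) y (v i)) =
        fun y => ε⁻¹ * (fun z => fderiv ℝ η z (v i)) (ε⁻¹ • y) :=
      funext fun y => fderiv_comp_smul_apply _ hd y _
    have hc : DifferentiableAt ℝ (fun y => (fun z => fderiv ℝ η z (v i)) (ε⁻¹ • y)) x :=
      hd'.comp (differentiable_id.const_smul ε⁻¹) x
    rw [e1, fderiv_const_mul hc, smul_apply, fderiv_comp_smul_apply _ hd', smul_eq_mul, abs_mul,
      abs_mul, abs_of_pos (inv_pos.2 hε), div_eq_inv_mul, ← mul_assoc, ← sq, inv_pow]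
    exact mul_le_mul_of_nonneg_left (hbd i j _) (by positivity)

end Cutoff

/-! ### Null images and pointwise limits of cutoffs -/

/-- A `C¹` image of a convex set of smaller dimension is a null set. -/
theorem volume_image_eq_zero_of_lt {k n : ℕ} (hk : k < n) {e : Coord k → Coord n}
    {s : Set (Coord k)} (hs : Convex ℝ s) (he : ContDiffOn ℝ 1 e s) : volume (e '' s) = 0 := by
  have h1 : dimH (e '' s) < n := by
    refine (he.dimH_image_le hs subset_rfl).trans_lt ((dimH_mono (Set.subset_univ s)).trans_lt ?_)
    rw [Real.dimH_univ_eq_finrank]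
    simpa using hk
  -- Lebesgue measure and `n`-dimensional Hausdorff measure are both Haar measures, so dimension
  -- below `n` forces volume zero.
  have h2 : (volume : Measure (Coord n)) ≪ Measure.hausdorffMeasure ((n : NNReal) : ℝ) := by
    have : (Measure.hausdorffMeasure ((n : NNReal) : ℝ) : Measure (Coord n)).IsAddHaarMeasure := by
      simpa using isAddHaarMeasure_hausdorffMeasure (E := Coord n)
    exact Measure.absolutelyContinuous_isAddHaarMeasure _ _
  exact measure_zero_of_dimH_lt h2 (by simpa using h1)

theorem tendsto_indicator_of_support_subset_thickening {X : Type*} [PseudoMetricSpace X] {K : Set X}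
    (hK : IsClosed K) {η : ℕ → X → ℝ} (h1 : ∀ j, ∀ x ∈ K, η j x = 1) {ε : ℕ → ℝ}
    (hε : Filter.Tendsto ε Filter.atTop (𝓝 0))
    (hsupp : ∀ j, Function.support (η j) ⊆ Metric.thickening (ε j) K) (x : X) :
    Filter.Tendsto (fun j => η j x) Filter.atTop (𝓝 (K.indicator 1 x)) := by
  by_cases hx : x ∈ K
  · simp [h1 _ x hx, hx]
  · obtain ⟨r, hr, hrK⟩ := Metric.isOpen_iff.1 hK.isOpen_compl x hx
    rw [Set.indicator_of_notMem hx]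
    refine tendsto_const_nhds.congr' ?_
    filter_upwards [hε.eventually_lt_const hr] with j hj
    by_contra h0
    obtain ⟨z, hz, hxz⟩ := Metric.mem_thickening_iff.1 (hsupp j (Ne.symm h0))
    exact hrK (Metric.mem_ball'.2 (hxz.trans hj)) hz

/-! ### The Frobenius norm against the components -/

section Density

variable {n : ℕ}

/-- The scalar factors pull out of the `ℓ²` norm of the entries. Measurability and integrability can
thus be read off from the components `logDensity g μ ν`. -/
theorem normLogDensity_eq_sqrt (g : Coord n → Matrix (Fin n) (Fin n) ℝ) (x : Coord n) :
    normLogDensity g x = √(∑ p : Fin n × Fin n, logDensity g p.1 p.2 x ^ 2) := by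
  have h1 : ∀ p : Fin n × Fin n, logDensity g p.1 p.2 x ^ 2 =
      (g x)⁻¹ p.1 p.2 ^ 2 * (|Real.log (g x).det| * volDensity g x) ^ 2 := by
    intro p
    rw [logDensity, mul_pow _ (volDensity g x), sq_abs]
    ring
  have h0 : 0 ≤ |Real.log (g x).det| * volDensity g x :=
    mul_nonneg (abs_nonneg _) (Real.sqrt_nonneg _)
  simp_rw [h1]
  rw [← Finset.sum_mul, Real.sqrt_mul (by positivity), Real.sqrt_sq h0, Fintype.sum_prod_type,
    normLogDensity, Matrix.frobenius_norm_def, ← Real.sqrt_eq_rpow, mul_assoc]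
  simp

theorem normLogDensity_nonneg (g : Coord n → Matrix (Fin n) (Fin n) ℝ) (x : Coord n) :
    0 ≤ normLogDensity g x := by
  rw [normLogDensity_eq_sqrt]
  exact Real.sqrt_nonneg _

theorem abs_logDensity_le (g : Coord n → Matrix (Fin n) (Fin n) ℝ) (μ ν : Fin n) (x : Coord n) :
    |logDensity g μ ν x| ≤ normLogDensity g x := by
  rw [normLogDensity_eq_sqrt]
  apply Real.abs_le_sqrt
  have h := Finset.single_le_sum (f := fun p : Fin n × Fin n => logDensity g p.1 p.2 x ^ 2)
    (fun p _ => sq_nonneg (logDensity g p.1 p.2 x)) (Finset.mem_univ (μ, ν))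
  exact h

theorem normLogDensity_le_sum (g : Coord n → Matrix (Fin n) (Fin n) ℝ) (x : Coord n) :
    normLogDensity g x ≤ ∑ p : Fin n × Fin n, |logDensity g p.1 p.2 x| := by
  rw [normLogDensity_eq_sqrt, Real.sqrt_le_left (Finset.sum_nonneg fun p _ => abs_nonneg _)]
  refine le_trans (le_of_eq ?_) (Finset.sum_sq_le_sq_sum_of_nonneg fun p _ => abs_nonneg _)
  simp only [sq_abs]

theorem integrableOn_normLogDensity {g : Coord n → Matrix (Fin n) (Fin n) ℝ} {s : Set (Coord n)}
    (hlog : ∀ μ ν, IntegrableOn (logDensity g μ ν) s) : IntegrableOn (normLogDensity g) s := by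
  have hsum : IntegrableOn (fun x => ∑ p : Fin n × Fin n, |logDensity g p.1 p.2 x|) s :=
    integrable_finsetSum _ fun p _ => (hlog p.1 p.2).abs
  refine hsum.mono' ?_ (.of_forall fun x => ?_)
  · have h : normLogDensity g = fun x => √(∑ p : Fin n × Fin n, logDensity g p.1 p.2 x ^ 2) :=
      funext (normLogDensity_eq_sqrt g)
    rw [h]
    refine Real.continuous_sqrt.comp_aestronglyMeasurable ?_
    exact Finset.aestronglyMeasurable_fun_sum _ fun p _ => (hlog p.1 p.2).aestronglyMeasurable.pow 2
  · rw [Real.norm_of_nonneg (normLogDensity_nonneg g x)]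
    exact normLogDensity_le_sum g x

end Density

/-! ### Second derivatives of test functions -/

section TestFunctionDerivatives

variable {n : ℕ} {U : Opens (Coord n)}

theorem lineDerivOp_testFunction_eq_fderiv (f : 𝓓(U, ℝ)) (v : Coord n) :
    ⇑(∂_{v} f : 𝓓(U, ℝ)) = fun x => fderiv ℝ f x v := by
  funext x
  rw [TestFunction.lineDerivOp_eq_lineDerivCLM ℝ, TestFunction.lineDerivCLM_apply_of_le (by simp)]
  exact (f.contDiff.differentiable (by simp)).differentiableAt.lineDeriv_eq_fderiv

theorem tsupport_lineDerivOp_subset (f : 𝓓(U, ℝ)) (v : Coord n) :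
    tsupport (∂_{v} f : 𝓓(U, ℝ)) ⊆ tsupport f := by
  rw [lineDerivOp_testFunction_eq_fderiv]
  exact tsupport_fderiv_apply_subset ℝ v

/-- A second order term of a distribution is controlled by a bound on the second derivatives. -/
theorem abs_integral_lineDerivOp_lineDerivOp_mul_le (f : 𝓓(U, ℝ)) (v w : Coord n) {M : ℝ}
    (hM : ∀ x, |(∂_{w} (∂_{v} f)) x| ≤ M) {h H : Coord n → ℝ} (hhH : ∀ x, |h x| ≤ H x)
    {s : Set (Coord n)} (hs : MeasurableSet s) (hfs : tsupport f ⊆ s) (hH : IntegrableOn H s) :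
    |∫ x, (∂_{w} (∂_{v} f)) x * h x| ≤ M * ∫ x in s, H x := by
  rw [← integral_const_mul, ← integral_indicator hs, ← Real.norm_eq_abs]
  refine norm_integral_le_of_norm_le ((integrable_indicator_iff hs).2 (hH.const_mul M))
    (.of_forall fun x => ?_)
  by_cases hx : x ∈ s
  · rw [Set.indicator_of_mem hx, norm_mul]
    exact mul_le_mul (hM x) (hhH x) (norm_nonneg _) ((abs_nonneg _).trans (hM x))
  · have h0 : (∂_{w} (∂_{v} f)) x = 0 := image_eq_zero_of_notMem_tsupport fun hx' =>
      hx (hfs (tsupport_lineDerivOp_subset _ _ (tsupport_lineDerivOp_subset _ _ hx')))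
    simp [h0, hx]

end TestFunctionDerivatives

/-! ### Limits of integrals and equality of measures -/

/-- Dominated convergence with majorant `|q|` on `D`. It is used with `q = 1` for the Radon measures
and with `q = quadDensity g dg` for Lebesgue measure. -/
theorem tendsto_integral_mul_of_tendsto_indicator {α : Type*} [MeasurableSpace α] {m : Measure α}
    {K D : Set α} (hK : MeasurableSet K) {η : ℕ → α → ℝ}
    (hη : ∀ j, Measurable (η j)) (h01 : ∀ j x, 0 ≤ η j x ∧ η j x ≤ 1)
    (hsupp : ∀ j, Function.support (η j) ⊆ D)
    (hlim : ∀ x, Filter.Tendsto (fun j => η j x) Filter.atTop (𝓝 (K.indicator 1 x)))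
    {q : α → ℝ} (hq : IntegrableOn q D m) :
    Filter.Tendsto (fun j => ∫ x, η j x * q x ∂m) Filter.atTop (𝓝 (∫ x in K, q x ∂m)) := by
  have e1 : ∀ j, ∫ x, η j x * q x ∂m = ∫ x in D, η j x * q x ∂m := fun j =>
    (setIntegral_eq_integral_of_forall_compl_eq_zero fun x hx => by
      rw [Function.notMem_support.1 fun h => hx (hsupp j h), zero_mul]).symm
  have hKD : K ⊆ D := by
    intro x hx
    by_contra hxD
    have h0 : ∀ j, η j x = 0 := fun j => Function.notMem_support.1 fun h => hxD (hsupp j h)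
    have := hlim x
    simp only [h0, Set.indicator_of_mem hx, Pi.one_apply] at this
    exact zero_ne_one (tendsto_nhds_unique tendsto_const_nhds this)
  have e2 : ∫ x in K, q x ∂m = ∫ x in D, K.indicator 1 x * q x ∂m := by
    have h : ∀ x, K.indicator 1 x * q x = K.indicator q x := fun x => by
      by_cases hx : x ∈ K <;> simp [hx]
    simp_rw [h]
    rw [setIntegral_indicator hK, Set.inter_eq_right.2 hKD]
  simp_rw [e1, e2]
  refine tendsto_integral_of_dominated_convergence (fun x => |q x|)
    (fun j => (hη j).aestronglyMeasurable.mul hq.aestronglyMeasurable) hq.abs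
    (fun j => .of_forall fun x => ?_) (.of_forall fun x => (hlim x).mul_const _)
  rw [norm_mul, Real.norm_of_nonneg (h01 j x).1]
  exact mul_le_of_le_one_left (norm_nonneg _) (h01 j x).2

/-- Two measures that are finite on a closed set and agree on its closed subsets agree on its
measurable subsets. -/
theorem measure_eq_of_forall_isClosed {α : Type*} [TopologicalSpace α] [MeasurableSpace α]
    [BorelSpace α] {m₁ m₂ : Measure α} {Z : Set α} (hZ : IsClosed Z) (hfin : m₁ Z < ⊤)
    (h : ∀ K ⊆ Z, IsClosed K → m₁ K = m₂ K) {W : Set α} (hWZ : W ⊆ Z) :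
    m₁ W = m₂ W := by
  have : IsFiniteMeasure (m₁.restrict Z) := ⟨by simpa using hfin⟩
  have hr : m₁.restrict Z = m₂.restrict Z := by
    refine ext_of_generate_finite {s : Set α | IsClosed s}
      (by rw [BorelSpace.measurable_eq (α := α), borel_eq_generateFrom_isClosed])
      isPiSystem_isClosed (fun s hs => ?_) ?_
    · rw [Measure.restrict_apply (IsClosed.measurableSet hs),
        Measure.restrict_apply (IsClosed.measurableSet hs)]
      exact h _ Set.inter_subset_right (IsClosed.inter hs hZ)
    · simpa using h Z subset_rfl hZ
  rw [← Measure.restrict_eq_self m₁ hWZ, hr, Measure.restrict_eq_self m₂ hWZ]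

/-! ### Vanishing of the curvature measure on `Z` -/

section ScalarCurvature

variable {n : ℕ} {U : Opens (Coord n)} {g : Coord n → Matrix (Fin n) (Fin n) ℝ}
  {dg : Fin n → Coord n → Matrix (Fin n) (Fin n) ℝ}

theorem tendsto_scalarCurvature_log_part
    (hlog : ∀ μ ν, IntegrableOn (logDensity g μ ν) (U : Set (Coord n))) {K Z : Set (Coord n)}
    (hKZ : K ⊆ Z)
    (hsmall : (fun ε : ℝ => ∫ x in Metric.thickening ε Z ∩ (U : Set (Coord n)),
      normLogDensity g x) =o[𝓝[>] 0] (fun ε : ℝ => ε ^ 2))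
    {C : ℝ} {ε : ℕ → ℝ} (hε0 : ∀ j, 0 < ε j)
    (hε : Filter.Tendsto ε Filter.atTop (𝓝 0)) {f : ℕ → 𝓓(U, ℝ)}
    (hsupp : ∀ j, tsupport (f j) ⊆ Metric.thickening (ε j) K) (μ ν : Fin n)
    (hbd : ∀ j x, |(∂_{coordVec ν} (∂_{coordVec μ} (f j))) x| ≤ C / ε j ^ 2) :
    Filter.Tendsto (fun j => ∫ x, (∂_{coordVec ν} (∂_{coordVec μ} (f j))) x * logDensity g μ ν x)
      Filter.atTop (𝓝 0) := by
  have hε' : Filter.Tendsto ε Filter.atTop (𝓝[>] 0) :=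
    tendsto_nhdsWithin_iff.2 ⟨hε, .of_forall hε0⟩
  have hlim : Filter.Tendsto (fun j => C * ((∫ x in Metric.thickening (ε j) Z ∩ (U : Set (Coord n)),
      normLogDensity g x) / ε j ^ 2)) Filter.atTop (𝓝 0) := by
    simpa using (hsmall.tendsto_div_nhds_zero.comp hε').const_mul C
  refine squeeze_zero_norm (fun j => ?_) hlim
  rw [Real.norm_eq_abs, ← mul_div_assoc, mul_div_right_comm]
  refine abs_integral_lineDerivOp_lineDerivOp_mul_le (f j) _ _ (hbd j) (abs_logDensity_le g μ ν)
    (Metric.isOpen_thickening.inter U.2).measurableSet ?_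
    ((integrableOn_normLogDensity hlog).mono_set Set.inter_subset_right)
  exact Set.subset_inter ((hsupp j).trans (Metric.thickening_subset_of_subset _ hKZ))
    (f j).tsupport_subset

/-- If the logarithmic term is `o(ε²)` near the null set `Z`, then the scalar curvature measure of
every compact subset of `Z` vanishes. -/
theorem measure_eq_of_isCompact_of_isSignedRadon
    (hlog : ∀ μ ν, IntegrableOn (logDensity g μ ν) (U : Set (Coord n)))
    (hquad : IntegrableOn (quadDensity g dg) (U : Set (Coord n))) {m₁ m₂ : Measure (Coord n)}
    (hm : IsSignedRadon (scalarCurvature U g dg) m₁ m₂) {K Z : Set (Coord n)} (hK : IsCompact K)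
    (hKU : K ⊆ (U : Set (Coord n))) (hKZ : K ⊆ Z) (hK0 : volume K = 0)
    (hsmall : (fun ε : ℝ => ∫ x in Metric.thickening ε Z ∩ (U : Set (Coord n)),
      normLogDensity g x) =o[𝓝[>] 0] (fun ε : ℝ => ε ^ 2)) :
    m₁ K = m₂ K := by
  -- All cutoffs are kept inside one compact subset of `U`, where `m₁` and `m₂` are finite; hence
  -- the scales `ε j ≤ δ` below.
  obtain ⟨δ, hδ, hδU⟩ := hK.exists_cthickening_subset_open U.2 hKU
  have hD : IsCompact (Metric.cthickening δ K) := hK.cthickening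
  obtain ⟨C, hcut⟩ := exists_cutoff (coordVec (n := n))
  let ε : ℕ → ℝ := fun j => δ * (1 / (j + 1))
  have hε0 : ∀ j, 0 < ε j := fun j => by positivity
  have hεδ : ∀ j, ε j ≤ δ := fun j =>
    mul_le_of_le_one_right hδ.le (div_le_one_of_le₀ (by simp) (by positivity))
  have hε : Filter.Tendsto ε Filter.atTop (𝓝 0) := by
    simpa [ε] using (tendsto_one_div_add_atTop_nhds_zero_nat (𝕜 := ℝ)).const_mul δ
  choose η hη h01 h1 hsupp hbd using fun j => hcut K (ε j) (hε0 j)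
  have hηD : ∀ j, tsupport (η j) ⊆ Metric.cthickening δ K := fun j =>
    (hsupp j).trans ((Metric.thickening_mono (hεδ j) K).trans
      (Metric.thickening_subset_cthickening δ K))
  let f : ℕ → 𝓓(U, ℝ) := fun j => ⟨η j, hη j,
    hD.of_isClosed_subset (isClosed_tsupport _) (hηD j), (hηD j).trans hδU⟩
  have hf : ∀ j, ⇑(f j) = η j := fun j => rfl
  have hf₂ : ∀ (j : ℕ) (μ ν : Fin n) (x : Coord n),
      |(∂_{coordVec ν} (∂_{coordVec μ} (f j))) x| ≤ C / ε j ^ 2 := by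
    intro j μ ν x
    rw [lineDerivOp_testFunction_eq_fderiv, lineDerivOp_testFunction_eq_fderiv]
    exact hbd j μ ν x
  have hind := tendsto_indicator_of_support_subset_thickening hK.isClosed h1 hε
    fun j => (subset_tsupport _).trans (hsupp j)
  have hlim : ∀ (m : Measure (Coord n)) (q : Coord n → ℝ),
      IntegrableOn q (Metric.cthickening δ K) m →
      Filter.Tendsto (fun j => ∫ x, η j x * q x ∂m) Filter.atTop (𝓝 (∫ x in K, q x ∂m)) :=
    fun m q hq => tendsto_integral_mul_of_tendsto_indicator hK.measurableSet
      (fun j => (hη j).continuous.measurable) h01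
      (fun j => (subset_tsupport _).trans (hηD j)) hind hq
  have hmeas : ∀ m : Measure (Coord n), m (Metric.cthickening δ K) < ⊤ →
      Filter.Tendsto (fun j => ∫ x, f j x ∂m) Filter.atTop (𝓝 (m.real K)) := by
    intro m hmD
    simpa [hf] using hlim m (fun _ => 1) (integrableOn_const hmD.ne)
  have hzero : Filter.Tendsto (fun j => scalarCurvature U g dg (f j)) Filter.atTop (𝓝 0) := by
    simp_rw [scalarCurvature_apply (fun μ ν => (hlog μ ν).locallyIntegrableOn)
      hquad.locallyIntegrableOn]
    have hq := hlim volume (quadDensity g dg) (hquad.mono_set hδU)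
    -- Since `K` is Lebesgue-null, the quadratic term disappears in the limit.
    rw [Measure.restrict_eq_zero.2 hK0, integral_zero_measure] at hq
    have hl := (tendsto_finsetSum Finset.univ fun μ _ => tendsto_finsetSum Finset.univ fun ν _ =>
      tendsto_scalarCurvature_log_part hlog hKZ hsmall hε0 hε (f := f) hsupp μ ν
        fun j x => hf₂ j μ ν x).const_mul (-(1 / 2))
    simpa [hf] using hl.add hq
  have h₁ := hmeas m₁ (hm.finite_left _ hδU hD)
  have h₂ := hmeas m₂ (hm.finite_right _ hδU hD)
  simp_rw [hm.apply_eq] at hzero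
  have heq : m₁.real K = m₂.real K := sub_eq_zero.1 (tendsto_nhds_unique (h₁.sub h₂) hzero)
  exact (measureReal_eq_measureReal_iff (hm.finite_left K hKU hK).ne
    (hm.finite_right K hKU hK).ne).1 heq

end ScalarCurvature

theorem theorem5 {n k : ℕ} (hk : k < n) (U : Opens (Coord n))
    (g : Coord n → Matrix (Fin n) (Fin n) ℝ)
    (dg : Fin n → Coord n → Matrix (Fin n) (Fin n) ℝ)
    (hg : IsHarmonicPatch U g dg)
    (hlog : ∀ μ ν, IntegrableOn (logDensity g μ ν) (U : Set (Coord n)))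
    (hquad : IntegrableOn (quadDensity g dg) (U : Set (Coord n)))
    (hmeas : IsMeasureDist (scalarCurvature U g dg))
    (e : Coord k → Coord n) (he : IsClosedBallEmbedding e)
    (heU : e '' closedUnitBall k ⊆ (U : Set (Coord n)))
    (hsmall : (fun ε : ℝ =>
        ∫ x in Metric.thickening ε (e '' closedUnitBall k) ∩ (U : Set (Coord n)),
          normLogDensity g x) =o[𝓝[>] 0] (fun ε : ℝ => ε ^ 2)) :
    (∃ m₁ m₂ : Measure (Coord n), IsSignedRadon (scalarCurvature U g dg) m₁ m₂) ∧
    ∀ m₁ m₂ : Measure (Coord n), IsSignedRadon (scalarCurvature U g dg) m₁ m₂ →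
      ∀ W : Set (Coord n), MeasurableSet W → W ⊆ e '' Metric.ball 0 1 → m₁ W = m₂ W := by
  refine ⟨hmeas.exists_isSignedRadon, fun m₁ m₂ hm W _ hWZ => ?_⟩
  have hZ : IsCompact (e '' closedUnitBall k) :=
    (isCompact_closedBall 0 1).image_of_continuousOn he.smooth.continuousOn
  have hZ0 : volume (e '' closedUnitBall k) = 0 :=
    volume_image_eq_zero_of_lt hk (convex_closedBall 0 1) (he.smooth.of_le (by norm_cast))
  -- The argument runs on the whole closed-ball image, whose compactness in `U` gives finite mass;
  -- the open ball enters only through inclusion.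
  exact measure_eq_of_forall_isClosed hZ.isClosed (hm.finite_left _ heU hZ)
    (fun K hKZ hK => measure_eq_of_isCompact_of_isSignedRadon hlog hquad hm
      (hZ.of_isClosed_subset hK hKZ) (hKZ.trans heU) hKZ (measure_mono_null hKZ hZ0) hsmall)
    (hWZ.trans (Set.image_mono Metric.ball_subset_closedBall))
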